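/- Let $L/\mathbb{Q}$ be a field extension of degree $3$, and let $p \neq 2,3$ be a prime number. Suppose that $L/\mathbb{Q}$ is ramified at $p$ and unramified at every prime number $q \neq p$ (no condition is imposed at the infinite place). Then $L/\mathbb{Q}$ is Galois if and only if $p$ is totally ramified in $L$, i.e. if and only if $p\,\mathcal{O}_L = \mathfrak{p}^3$ for some prime ideal $\mathfrak{p}$ of the ring of integers $\mathcal{O}_L$. -/

import Mathlib

open scoped NumberField

/-- The rational prime `p` is ramified in the number field `L`: some prime of `𝓞 L` above `p` is
ramified over `ℤ`. -/
def RamifiedAt (L : Type*) [Field L] [NumberField L] (p : ℕ) : Prop :=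
  ¬ Algebra.IsUnramifiedIn (𝓞 L) (Ideal.span {(p : ℤ)})

/-- The rational prime `p` is totally ramified in the number field `L`: `p 𝓞_L = 𝔭 ^ [L : ℚ]` for
some prime ideal `𝔭` of `𝓞 L`. -/
def TotallyRamifiedAt (L : Type*) [Field L] [NumberField L] (p : ℕ) : Prop :=
  ∃ 𝔭 : Ideal (𝓞 L), 𝔭.IsPrime ∧
    Ideal.map (algebraMap ℤ (𝓞 L)) (Ideal.span {(p : ℤ)}) = 𝔭 ^ Module.finrank ℚ L

/-! An automorphism of an algebraically closed field permutes the embeddings of `L`, hence the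
columns of the matrix whose squared determinant is the discriminant. This has two consequences.

* Writing the determinant as `P - N`, with `P` and `N` the contributions of the even and of the odd
  permutations, the discriminant is `(P + N) ^ 2 - 4 * P * N` with `P + N` and `P * N` integers, so
  it is `0` or `1` modulo `4` (Stickelberger).
* If the discriminant is a square, the embeddings are permuted evenly. An automorphism over `L`
  fixes one of at most three embeddings, and so it fixes them all: `L` is Galois.

If `p` is totally ramified in the cubic field `L`, the ramification is tame because `p ≠ 3`, so the
different has exponent exactly `2` at the prime above `p`. As no other prime ramifies, the
discriminant is `± p ^ 2`, and Stickelberger's congruence forces the sign `+`. Conversely, in a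
Galois extension of prime degree a ramification index divides the degree, so it is `1` or
maximal. -/

open Module Equiv.Perm

section FixedElements

variable {K E : Type*} [Field K] [Field E] [Algebra K E] [Normal K E]

theorem mem_range_algebraMap_of_forall_fixed {x : E} (hsep : IsSeparable K x)
    (hfix : ∀ τ : Gal(E/K), τ x = x) : x ∈ (algebraMap K E).range := by
  by_contra hx
  obtain ⟨y, hxy, hconj⟩ :=
    (notMem_iff_exists_ne_and_isConjRoot hsep (Normal.splits inferInstance x)).mp hx
  obtain ⟨τ, hτ⟩ := hconj.exists_algEquiv
  exact hxy (τ.injective ((hfix τ).trans hτ.symm))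

theorem exists_algebraMap_eq_of_forall_fixed {R : Type*} [CommRing R] [IsIntegrallyClosed R]
    [Algebra R K] [IsFractionRing R K] [Algebra R E] [IsScalarTower R K E] {x : E}
    (hint : IsIntegral R x) (hsep : IsSeparable K x) (hfix : ∀ τ : Gal(E/K), τ x = x) :
    ∃ r : R, algebraMap R E r = x := by
  obtain ⟨y, rfl⟩ := mem_range_algebraMap_of_forall_fixed hsep hfix
  obtain ⟨r, rfl⟩ := IsIntegrallyClosed.isIntegral_iff.mp
    ((isIntegral_algebraMap_iff (algebraMap K E).injective).mp hint)
  exact ⟨r, IsScalarTower.algebraMap_apply R K E r⟩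

end FixedElements

theorem normal_of_forall_mem_range_algebraMap {K L E : Type*} [Field K] [Field L] [Field E]
    [Algebra K L] [Algebra K E] [Algebra L E] [IsScalarTower K L E] [Normal K E]
    (h : ∀ (σ : L →ₐ[K] E) (x : L), σ x ∈ (algebraMap L E).range) : Normal K L := by
  let φ : L ≃ₐ[K] (IsScalarTower.toAlgHom K L E).fieldRange := AlgEquiv.ofInjectiveField _
  have : Normal K (IsScalarTower.toAlgHom K L E).fieldRange := by
    rw [IntermediateField.normal_iff_forall_fieldRange_le]
    rintro σ _ ⟨y, rfl⟩
    simpa using h (σ.comp φ) (φ.symm y)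
  exact Normal.of_algEquiv φ.symm

theorem eq_one_of_sign_eq_one_of_apply_eq {ι : Type*} [Fintype ι] [DecidableEq ι]
    (hcard : Fintype.card ι ≤ 3) {π : Equiv.Perm ι} {i : ι} (hsign : sign π = 1)
    (hi : π i = i) : π = 1 := by
  have hsupp : π.support.card < 3 :=
    (Finset.card_lt_univ_of_notMem (notMem_support.mpr hi)).trans_le hcard
  have hswap : π.support.card ≠ 2 := fun h ↦ by
    simp [(card_support_eq_two.mp h).sign_eq] at hsign
  exact card_support_le_one.mp (by lia)

section LeibnizPart

variable {ι : Type*} [Fintype ι] [DecidableEq ι] {A B : Type*} [CommRing A] [CommRing B]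

/-- The sum of the terms of the Leibniz expansion of `det M` coming from the permutations of sign
`s`, taken without that sign. Permuting the columns of `M` by an odd permutation swaps the parts for
`1` and `-1`, so their sum and their product are symmetric in the columns. -/
def leibnizPart (s : ℤˣ) (M : Matrix ι ι A) : A :=
  ∑ π : Equiv.Perm ι with sign π = s, ∏ i, M (π i) i

theorem det_eq_leibnizPart_sub (M : Matrix ι ι A) :
    M.det = leibnizPart 1 M - leibnizPart (-1) M := by
  simp only [leibnizPart, Matrix.det_apply, Finset.sum_filter, ← Finset.sum_sub_distrib]
  refine Finset.sum_congr rfl fun π _ ↦ ?_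
  rcases Int.units_eq_one_or (sign π) with h | h <;> simp [h]

theorem map_leibnizPart {F : Type*} [FunLike F A B] [RingHomClass F A B] (f : F) (s : ℤˣ)
    (M : Matrix ι ι A) : f (leibnizPart s M) = leibnizPart s (M.map f) := by
  simp [leibnizPart]

theorem leibnizPart_submatrix (s : ℤˣ) (M : Matrix ι ι A) (ρ : Equiv.Perm ι) :
    leibnizPart s (M.submatrix id ρ) = leibnizPart (s * sign ρ) M := by
  refine Finset.sum_equiv (Equiv.mulRight ρ⁻¹) (fun π ↦ ?_) fun π _ ↦ ?_
  · simp
  · exact Fintype.prod_equiv ρ _ _ fun i ↦ by simp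

theorem leibnizPart_mem {S : Type*} [SetLike S A] [SubringClass S A] {T : S} {M : Matrix ι ι A}
    (hM : ∀ i j, M i j ∈ T) (s : ℤˣ) : leibnizPart s M ∈ T :=
  sum_mem fun _ _ ↦ prod_mem fun _ _ ↦ hM _ _

end LeibnizPart

section Embeddings

variable {K L E ι : Type*} [Field K] [Field L] [Field E] [Algebra K L] [Algebra K E]

/-- The permutation of `ι` through which an automorphism `τ` of `E` acts by composition on the
embeddings of `L` into `E`, enumerated by `e`. It is how `τ` acts on the columns of the embeddings
matrix. -/
def embeddingsPerm (e : ι ≃ (L →ₐ[K] E)) (τ : Gal(E/K)) : Equiv.Perm ι :=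
  e.permCongr.symm (AlgEquiv.refl.arrowCongr τ)

theorem apply_embeddingsPerm (e : ι ≃ (L →ₐ[K] E)) (τ : Gal(E/K)) (i : ι) (x : L) :
    e (embeddingsPerm e τ i) x = τ (e i x) := by
  simp [embeddingsPerm, Equiv.permCongr_def]

theorem embeddingsMatrixReindex_map (b : ι → L) (e : ι ≃ (L →ₐ[K] E)) (τ : Gal(E/K)) :
    (Algebra.embeddingsMatrixReindex K E b e).map τ =
      (Algebra.embeddingsMatrixReindex K E b e).submatrix id (embeddingsPerm e τ) := by
  ext i j
  exact (apply_embeddingsPerm e τ j (b i)).symm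

variable [FiniteDimensional K L] [Algebra.IsSeparable K L] [IsAlgClosed E] [Fintype ι]
  [DecidableEq ι]

theorem exists_discr_eq_sq_add_four_mul_of_normal [Normal K E] {R : Type*} [CommRing R]
    [IsIntegrallyClosed R] [Algebra R K] [IsFractionRing R K] [Algebra R L] [IsScalarTower R K L]
    [Algebra R E] [IsScalarTower R K E] {b : ι → L} (hb : ∀ i, IsIntegral R (b i))
    (e : ι ≃ (L →ₐ[K] E)) :
    ∃ u v : R, Algebra.discr K b = algebraMap R K (u ^ 2 + 4 * v) := by
  set M := Algebra.embeddingsMatrixReindex K E b e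
  have hint (s : ℤˣ) : IsIntegral R (leibnizPart s M) :=
    leibnizPart_mem (T := integralClosure R E)
      (fun i j ↦ (hb i).map ((e j).restrictScalars R)) s
  have hsep (s : ℤˣ) : leibnizPart s M ∈ separableClosure K E :=
    leibnizPart_mem (fun i j ↦ mem_separableClosure_iff.mpr <|
      .map (e j) (e j).injective (Algebra.IsSeparable.isSeparable K (b i))) s
  have hτ (τ : Gal(E/K)) (s : ℤˣ) :
      τ (leibnizPart s M) = leibnizPart (s * sign (embeddingsPerm e τ)) M := by
    rw [map_leibnizPart, embeddingsMatrixReindex_map, leibnizPart_submatrix]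
  obtain ⟨u, hu⟩ : ∃ u : R, algebraMap R E u = leibnizPart 1 M + leibnizPart (-1) M := by
    refine exists_algebraMap_eq_of_forall_fixed ((hint 1).add (hint (-1)))
      (add_mem (hsep 1) (hsep (-1))) fun τ ↦ ?_
    rw [map_add, hτ, hτ]
    rcases Int.units_eq_one_or (sign (embeddingsPerm e τ)) with h | h <;> simp [h, add_comm]
  obtain ⟨v, hv⟩ : ∃ v : R, algebraMap R E v = leibnizPart 1 M * leibnizPart (-1) M := by
    refine exists_algebraMap_eq_of_forall_fixed ((hint 1).mul (hint (-1)))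
      (mul_mem (hsep 1) (hsep (-1))) fun τ ↦ ?_
    rw [map_mul, hτ, hτ]
    rcases Int.units_eq_one_or (sign (embeddingsPerm e τ)) with h | h <;> simp [h, mul_comm]
  refine ⟨u, -v, (algebraMap K E).injective ?_⟩
  rw [Algebra.discr_eq_det_embeddingsMatrixReindex_pow_two K E b e, det_eq_leibnizPart_sub,
    ← IsScalarTower.algebraMap_apply R K E, map_add, map_pow, map_mul, map_neg, hu, hv, map_ofNat]
  ring

theorem sign_embeddingsPerm_eq_one [NeZero (2 : K)] (b : Basis ι K L)
    (hsq : IsSquare (Algebra.discr K b)) (e : ι ≃ (L →ₐ[K] E)) (τ : Gal(E/K)) :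
    sign (embeddingsPerm e τ) = 1 := by
  set M := Algebra.embeddingsMatrixReindex K E b e with hM
  obtain ⟨m, hm⟩ := hsq
  have hdet : M.det ^ 2 = algebraMap K E m ^ 2 := by
    rw [← Algebra.discr_eq_det_embeddingsMatrixReindex_pow_two, hm, ← pow_two, map_pow]
  have hdet_ne : M.det ≠ 0 := by
    rw [← pow_ne_zero_iff two_ne_zero, ← Algebra.discr_eq_det_embeddingsMatrixReindex_pow_two]
    exact (map_ne_zero _).mpr (Algebra.discr_not_zero_of_basis K b)
  have hfix : τ M.det = M.det := by
    rcases sq_eq_sq_iff_eq_or_eq_neg.mp hdet with h | h <;> simp [h]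
  have hperm : τ M.det = sign (embeddingsPerm e τ) * M.det := by
    rw [← Matrix.det_permute', ← embeddingsMatrixReindex_map, ← hM]
    exact τ.toRingEquiv.map_det M
  have htwo : (2 : E) ≠ 0 := by
    rw [← map_ofNat (algebraMap K E), map_ne_zero]
    exact two_ne_zero
  refine (Int.units_eq_one_or _).resolve_right fun hsign ↦ ?_
  rw [hfix, hsign, Units.val_neg, Units.val_one, Int.cast_neg, Int.cast_one, neg_one_mul,
    eq_neg_iff_add_eq_zero, ← two_mul] at hperm
  exact mul_ne_zero htwo hdet_ne hperm

end Embeddings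

section Discriminant

variable {K L ι : Type*} [Field K] [Field L] [Algebra K L] [FiniteDimensional K L]
  [Algebra.IsSeparable K L] [Fintype ι] [DecidableEq ι]

theorem exists_discr_eq_sq_add_four_mul {R : Type*} [CommRing R] [IsIntegrallyClosed R]
    [Algebra R K] [IsFractionRing R K] [Algebra R L] [IsScalarTower R K L] {b : ι → L}
    (hcard : Fintype.card ι = finrank K L) (hb : ∀ i, IsIntegral R (b i)) :
    ∃ u v : R, Algebra.discr K b = algebraMap R K (u ^ 2 + 4 * v) :=
  exists_discr_eq_sq_add_four_mul_of_normal hb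
    (Fintype.equivOfCardEq (hcard.trans (AlgHom.card K L (AlgebraicClosure K)).symm))

theorem isGalois_of_isSquare_discr [NeZero (2 : K)] (hdeg : finrank K L ≤ 3) (b : Basis ι K L)
    (hsq : IsSquare (Algebra.discr K b)) : IsGalois K L := by
  let E := AlgebraicClosure L
  have hcard : Fintype.card ι = finrank K L := (finrank_eq_card_basis b).symm
  let e : ι ≃ (L →ₐ[K] E) := Fintype.equivOfCardEq (hcard.trans (AlgHom.card K L E).symm)
  have hfixed (τ : Gal(E/L)) (σ : L →ₐ[K] E) (x : L) : τ (σ x) = σ x := by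
    let π := embeddingsPerm e (τ.restrictScalars K)
    let i := e.symm (IsScalarTower.toAlgHom K L E)
    have hπ (j : ι) (y : L) : e (π j) y = τ (e j y) := apply_embeddingsPerm ..
    have hi : π i = i := e.injective <| AlgHom.ext fun y ↦ by rw [hπ]; simp [i]
    have : π = 1 := eq_one_of_sign_eq_one_of_apply_eq (hcard.trans_le hdeg)
      (sign_embeddingsPerm_eq_one b hsq e _) hi
    simpa [this] using (hπ (e.symm σ) x).symm
  have : IsAlgClosure K E := IsAlgClosure.ofAlgebraic K L E
  have hsep (σ : L →ₐ[K] E) (x : L) : IsSeparable K (σ x) :=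
    .map σ σ.injective (Algebra.IsSeparable.isSeparable K x)
  have : Normal K L := normal_of_forall_mem_range_algebraMap (E := E) fun σ x ↦
    mem_range_algebraMap_of_forall_fixed ((hsep σ x).tower_top L) (hfixed · σ x)
  exact {}

end Discriminant

section GaloisRamification

variable {A B : Type*} [CommRing A] [IsDomain A] [CommRing B] [IsDedekindDomain B] [Algebra A B]
  [Module.Finite A B] [Module.Flat A B]

theorem map_eq_pow_card_of_ramificationIdx_ne_one (G : Type*) [Group G] [MulSemiringAction G B]
    [IsGaloisGroup G A B] (hG : (Nat.card G).Prime) {𝔭 : Ideal A} [𝔭.IsMaximal] (hp0 : 𝔭 ≠ ⊥)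
    (P : Ideal B) [P.IsPrime] [P.LiesOver 𝔭] (hP : P.ramificationIdx A ≠ 1) :
    𝔭.map (algebraMap A B) = P ^ Nat.card G := by
  have : Finite G := (Nat.card_pos_iff.mp hG.pos).2
  have hcard := Ideal.ncard_primesOver_mul_ramificationIdxIn_mul_inertiaDegIn 𝔭 B G
  rw [Ideal.ramificationIdxIn_eq_ramificationIdx 𝔭 P G, mul_left_comm] at hcard
  have he : P.ramificationIdx A = Nat.card G :=
    ((Nat.dvd_prime hG).mp ⟨_, hcard.symm⟩).resolve_left hP
  have hone : (𝔭.primesOver B).ncard = 1 :=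
    Nat.eq_one_of_mul_eq_one_right <| (Nat.mul_eq_left hG.ne_zero).mp (he ▸ hcard)
  have hover : 𝔭.primesOver B = {P} := by
    obtain ⟨Q, hQ⟩ := Set.ncard_eq_one.mp hone
    have hPQ : P ∈ 𝔭.primesOver B := ⟨inferInstance, inferInstance⟩
    rw [hQ, Set.mem_singleton_iff] at hPQ
    rw [hQ, hPQ]
  rw [Ideal.map_algebraMap_eq_finsetProd_pow hp0, ← he]
  simp [hover]

end GaloisRamification

section Different

attribute [local instance] FractionRing.liftAlgebra

variable {A B : Type*} [CommRing A] [IsDedekindDomain A] [CommRing B] [IsDedekindDomain B]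
  [Algebra A B] [Module.Finite A B] [Module.Free A B]
  [Algebra.IsSeparable (FractionRing A) (FractionRing B)]

theorem not_map_algebraMap_dvd_differentIdeal {𝔭 : Ideal A} (hrank : (finrank A B : A) ∉ 𝔭) :
    ¬ 𝔭.map (algebraMap A B) ∣ differentIdeal A B := by
  refine not_dvd_differentIdeal_of_intTrace_not_mem A _ ⊤ (Ideal.mul_top _) 1 trivial ?_
  rwa [Algebra.intTrace_eq_trace, ← map_one (algebraMap A B), Algebra.trace_algebraMap,
    nsmul_one]

theorem emultiplicity_differentIdeal_of_map_eq_pow {𝔭 : Ideal A} [𝔭.IsMaximal] (hp0 : 𝔭 ≠ ⊥)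
    {P : Ideal B} {e : ℕ} (hP : 𝔭.map (algebraMap A B) = P ^ e)
    (hrank : (finrank A B : A) ∉ 𝔭) :
    emultiplicity P (differentIdeal A B) = (e - 1 : ℕ) := by
  have hnot := not_map_algebraMap_dvd_differentIdeal (B := B) hrank
  rw [hP] at hnot
  have he : e ≠ 0 := by
    rintro rfl
    exact hnot (one_dvd _)
  rw [emultiplicity_eq_coe, Nat.sub_one_add_one he]
  exact ⟨pow_sub_one_dvd_differentIdeal A P e hp0 hP.symm.dvd, hnot⟩

end Different

theorem dvd_of_span_natCast_eq_pow_of_dvd_absNorm {B : Type*} [CommRing B] [IsDedekindDomain B]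
    [Module.Free ℤ B] [Module.Finite ℤ B] {p n : ℕ} (hp : p.Prime) {P J : Ideal B} [P.IsMaximal]
    (hP : Ideal.span {(p : B)} = P ^ n) (hJ : p ∣ Ideal.absNorm J) : P ∣ J := by
  obtain ⟨M, hM, hMp, hMJ⟩ := Ideal.exists_isMaximal_dvd_of_dvd_absNorm' hp J hJ
  have hpM : (p : B) ∈ M := by
    have : (p : ℤ) ∈ M.under ℤ := hMp ▸ Ideal.mem_span_singleton_self _
    simpa using this
  have hPM : P ≤ M := hM.isPrime.le_of_pow_le (n := n) <| by simpa [← hP, Ideal.span_le] using hpM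
  rwa [‹P.IsMaximal›.eq_of_le hM.ne_top hPM]

section NumberField

variable (L : Type*) [Field L] [NumberField L]

theorem discr_emod_four : NumberField.discr L % 4 = 0 ∨ NumberField.discr L % 4 = 1 := by
  have hint i : IsIntegral ℤ (NumberField.integralBasis L i) := by
    rw [NumberField.integralBasis_apply]
    exact (NumberField.RingOfIntegers.basis L i).isIntegral_coe
  obtain ⟨u, v, huv⟩ := exists_discr_eq_sq_add_four_mul
    (finrank_eq_card_basis (NumberField.integralBasis L)).symm hint
  have hdiscr : NumberField.discr L = u ^ 2 + 4 * v :=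
    (algebraMap ℤ ℚ).injective_int ((NumberField.coe_discr L).trans huv)
  rw [hdiscr, Int.add_mul_emod_self_left]
  rcases Int.even_or_odd u with hu | hu
  · exact .inl <| Int.emod_eq_zero_of_dvd <| by simpa using pow_dvd_pow_of_dvd hu.two_dvd 2
  · exact .inr <| Int.sq_mod_four_eq_one_of_odd hu

theorem discr_eq_sq_of_natAbs_eq_sq {m : ℕ} (hm : Odd m)
    (h : (NumberField.discr L).natAbs = m ^ 2) : NumberField.discr L = m ^ 2 := by
  have hmod : (m : ℤ) ^ 2 % 4 = 1 := Int.sq_mod_four_eq_one_of_odd (by exact_mod_cast hm)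
  have habs : |NumberField.discr L| = (m : ℤ) ^ 2 := by
    rw [Int.abs_eq_natAbs, h, Nat.cast_pow]
  have := discr_emod_four L
  rcases eq_or_eq_neg_of_abs_eq habs with h | h <;> lia

variable {L} in
theorem isGalois_of_isSquare_numberFieldDiscr (hdeg : finrank ℚ L ≤ 3)
    (hsq : IsSquare (NumberField.discr L)) : IsGalois ℚ L :=
  isGalois_of_isSquare_discr hdeg (NumberField.integralBasis L) <| by
    rw [← NumberField.coe_discr]
    exact hsq.map (Int.castRingHom ℚ)

variable {p : ℕ}

theorem natCast_dvd_discr_iff_ramifiedAt (hp : p.Prime) :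
    (p : ℤ) ∣ NumberField.discr L ↔ RamifiedAt L p := by
  rw [RamifiedAt, ← NumberField.not_dvd_discr_iff_isUnramifiedIn L (𝓞 L)
    (Nat.prime_iff_prime_int.mp hp), not_not]

theorem exists_natAbs_discr_eq_pow (hunram : ∀ q : ℕ, q.Prime → q ≠ p → ¬ RamifiedAt L q) :
    ∃ k : ℕ, (NumberField.discr L).natAbs = p ^ k := by
  refine ⟨_, Nat.eq_prime_pow_of_unique_prime_dvd
    (Int.natAbs_ne_zero.mpr (NumberField.discr_ne_zero L)) fun {q} hq hdvd ↦ ?_⟩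
  by_contra hne
  exact hunram q hq hne <|
    (natCast_dvd_discr_iff_ramifiedAt L hq).mp (Int.natCast_dvd.mpr hdvd)

variable {L}

theorem absNorm_eq_of_span_natCast_eq_pow_finrank {P : Ideal (𝓞 L)}
    (hP : Ideal.span {(p : 𝓞 L)} = P ^ finrank ℚ L) : Ideal.absNorm P = p := by
  have h := congrArg Ideal.absNorm hP
  rw [map_pow, Ideal.absNorm_span_natCast, NumberField.RingOfIntegers.rank] at h
  exact (Nat.pow_left_injective finrank_pos.ne' h).symm

theorem RamifiedAt.totallyRamifiedAt [IsGalois ℚ L] (hdeg : (finrank ℚ L).Prime) (hp : p.Prime)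
    (hram : RamifiedAt L p) : TotallyRamifiedAt L p := by
  have : Fact p.Prime := ⟨hp⟩
  have := Int.ideal_span_isMaximal_of_prime p
  rw [RamifiedAt, Algebra.isUnramifiedIn_iff_forall_ramificationIdx_eq_one] at hram
  push Not at hram
  obtain ⟨P, hPprime, hPover, hP⟩ := hram
  rw [← IsGaloisGroup.card_eq_finrank Gal(L/ℚ)] at hdeg
  rw [TotallyRamifiedAt, ← IsGaloisGroup.card_eq_finrank Gal(L/ℚ)]
  exact ⟨P, hPprime, map_eq_pow_card_of_ramificationIdx_ne_one Gal(L/ℚ) hdeg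
    (by simpa using hp.ne_zero) P hP⟩

theorem TotallyRamifiedAt.padicValNat_natAbs_discr (hp : p.Prime) (htame : ¬ p ∣ finrank ℚ L)
    (htot : TotallyRamifiedAt L p) :
    padicValNat p (NumberField.discr L).natAbs = finrank ℚ L - 1 := by
  have : Fact p.Prime := ⟨hp⟩
  have := Int.ideal_span_isMaximal_of_prime p
  obtain ⟨P, hPprime, hmap⟩ := htot
  have hP : Ideal.span {(p : 𝓞 L)} = P ^ finrank ℚ L := by simpa [Ideal.map_span] using hmap
  have hnorm : Ideal.absNorm P = p := absNorm_eq_of_span_natCast_eq_pow_finrank hP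
  have : P.IsMaximal := hPprime.isMaximal <| by
    rintro rfl
    exact hp.ne_zero (by simpa using hnorm.symm)
  have hmult : emultiplicity P (differentIdeal ℤ (𝓞 L)) = (finrank ℚ L - 1 : ℕ) :=
    emultiplicity_differentIdeal_of_map_eq_pow (by simpa using hp.ne_zero) hmap <| by
      rwa [NumberField.RingOfIntegers.rank, Ideal.mem_span_singleton, Int.natCast_dvd_natCast]
  obtain ⟨⟨J, hJ⟩, hnot⟩ := emultiplicity_eq_coe.mp hmult
  have hpJ : ¬ p ∣ Ideal.absNorm J := fun h ↦ hnot <| by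
    rw [hJ, pow_succ]
    exact mul_dvd_mul_left _ (dvd_of_span_natCast_eq_pow_of_dvd_absNorm hp hP h)
  have hJ0 : Ideal.absNorm J ≠ 0 := fun h ↦ hpJ (h ▸ dvd_zero p)
  rw [← NumberField.absNorm_differentIdeal L (𝓞 L), hJ, map_mul, map_pow, hnorm,
    padicValNat.mul (pow_ne_zero _ hp.ne_zero) hJ0, padicValNat.prime_pow,
    padicValNat.eq_zero_of_not_dvd hpJ, add_zero]

theorem TotallyRamifiedAt.natAbs_discr_eq_pow (hp : p.Prime) (htame : ¬ p ∣ finrank ℚ L)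
    (htot : TotallyRamifiedAt L p) (hunram : ∀ q : ℕ, q.Prime → q ≠ p → ¬ RamifiedAt L q) :
    (NumberField.discr L).natAbs = p ^ (finrank ℚ L - 1) := by
  have : Fact p.Prime := ⟨hp⟩
  obtain ⟨k, hk⟩ := exists_natAbs_discr_eq_pow L hunram
  rw [← htot.padicValNat_natAbs_discr hp htame, hk, padicValNat.prime_pow]

end NumberField

theorem lemma3p2 (L : Type*) [Field L] [NumberField L] (hdeg : Module.finrank ℚ L = 3)
    (p : ℕ) (hp : p.Prime) (hp2 : p ≠ 2) (hp3 : p ≠ 3)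
    (hram : RamifiedAt L p)
    (hunram : ∀ q : ℕ, q.Prime → q ≠ p → ¬ RamifiedAt L q) :
    IsGalois ℚ L ↔ TotallyRamifiedAt L p := by
  refine ⟨fun _ ↦ hram.totallyRamifiedAt (hdeg ▸ Nat.prime_three) hp, fun htot ↦ ?_⟩
  have htame : ¬ p ∣ finrank ℚ L := by rwa [hdeg, Nat.prime_dvd_prime_iff_eq hp Nat.prime_three]
  have habs : (NumberField.discr L).natAbs = p ^ 2 := by
    rw [htot.natAbs_discr_eq_pow hp htame hunram, hdeg]
  have hdiscr : NumberField.discr L = p ^ 2 :=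
    discr_eq_sq_of_natAbs_eq_sq L (hp.odd_of_ne_two hp2) habs
  exact isGalois_of_isSquare_numberFieldDiscr hdeg.le (hdiscr ▸ IsSquare.sq _)
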